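/- **Setting.** Let $M$ be a matroid on a finite ground set $E$, of rank $D$, with set of bases $\mathcal B$. For $t\ge 0$ and $e\in E$ let $X_e(t)$ be real random variables such that, for each $e$, the variables $(X_e(t))_{t\ge 0}$ are identically distributed with mean $\mu_e\in(0,\infty)$ and $X_e(t)-\mu_e$ is $\tfrac14$-sub-Gaussian, i.e. $\mathbb E[e^{\lambda(X_e(t)-\mu_e)}]\le e^{\lambda^2/8}$ for all $\lambda\in\mathbb R$ (for instance $X_e(t)\in[0,1]$). The vectors $(X_e(t))_{e\in E}$, $t\ge 0$, are independent over time, while the entries of one vector may be correlated: there is a filtration $(\mathcal F_t)_{t\ge0}$ such that $X(t)$ is $\mathcal F_t$-measurable and $X(t+1)$ is independent of $\mathcal F_t$. The means $\mu_e$ are pairwise distinct. For $w\in\mathbb R^E$ and $B\subseteq E$ write $w_B=\sum_{e\in B}w_e$. **The algorithm MAUB.** It produces leaders $L(t)$, neighborhoods $\mathcal N(t)$ and played sets $P(t)$; $L(t+1)$ and $P(t+1)$ are $\mathcal F_t$-measurable. With $P(0)=E$ (every element is observed once initially), put $$N_e(t)=\#\{0\le s\le t: e\in P(s)\},\qquad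 \hat\mu_e(t)=\frac1{N_e(t)}\sum_{0\le s\le t,\ e\in P(s)}X_e(s),\qquad l_B(t)=\#\{1\le s\le t: L(s)=B\}.$$ * $\mathrm{greedy}(w)$ goes through $E$ in nonincreasing order of $w$ and adds an element to the current set, initially $\emptyset$, whenever independence is preserved. * $\mathrm{Neighbors}(B,w)$ goes through the elements $x\in B$ in nondecreasing order of $w$; for each $x$ and each not yet mapped $e\in E\setminus B$ with $B-x+e\in\mathcal B$, it adds $B-x+e$ to the neighborhood and marks $e$ as mapped. * Initially $L(0)=\mathrm{greedy}(\hat\mu(0))$ and $\mathcal N(0)=\mathrm{Neighbors}(L(0),\hat\mu(0))$. * At each step $t\ge1$: 1. If $\hat\mu_{L(t-1)}(t-1)<\hat\mu_{J}(t-1)$ for some $J\in\mathcal N(t-1)$, then $L(t)=\mathrm{greedy}(\hat\mu(t-1))$ and $\mathcal N(t)=\mathrm{Neighbors}(L(t),\hat\mu(t-1))$. Otherwise $L(t)=L(t-1)$; in that case, if $t\ge2$ and $\hat\mu(t-1)$ orders the elements of $L(t)$ differently from $\hat\mu(t-2)$, then $\mathcal N(t)=\mathrm{Neighbors}(L(t),\hat\mu(t-1))$,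 and else $\mathcal N(t)=\mathcal N(t-1)$. 2. If $l_{L(t)}(t)-1$ is divisible by $|E|-D+1$, then $P(t)=L(t)$. Otherwise $P(t)$ maximizes, over $J\in\{L(t)\}\cup\mathcal N(t)$, the optimistic value $$\sum_{e\in J}\Big(\hat\mu_e(t-1)+\sqrt{2\log(l_{L(t)}(t))/N_e(t-1)}\Big).$$ 3. $X_e(t)$ is observed for $e\in P(t)$. Ties in the orderings and in the maximization are broken arbitrarily. **Theorem (time spent in suboptimal arms).** Let $B\in\mathcal B$ be suboptimal, i.e. $\mu_B<\max_{B'\in\mathcal B}\mu_{B'}$. Then under MAUB $$\mathbb E[l_B(T)]=\mathcal O(\log\log T)\qquad(T\to\infty).$$ -/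

import Mathlib

open Finset MeasureTheory ProbabilityTheory Asymptotics Filter

namespace MAUB

noncomputable section

variable {E : Type*} [Fintype E] [DecidableEq E]

/-- The additive value `∑ e ∈ B, w e` of a set `B` of elements. -/
def weight (w : E → ℝ) (B : Finset E) : ℝ := ∑ e ∈ B, w e

open Classical in
/-- The greedy loop run along the list `l`: an element is added as soon as this keeps the current
set independent. -/
def greedyAlong (M : Matroid E) (l : List E) : Finset E :=
  l.foldl (fun I e => if M.Indep (↑(insert e I) : Set E) then insert e I else I) ∅

/-- `B` is an output of the greedy algorithm with values `w`, for some ordering of all elements by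
nonincreasing value (ties are ordered arbitrarily). -/
def IsGreedyOutput (M : Matroid E) (w : E → ℝ) (B : Finset E) : Prop :=
  ∃ l : List E, l.Nodup ∧ (∀ e, e ∈ l) ∧ l.Pairwise (fun a b => w b ≤ w a) ∧
    B = greedyAlong M l

open Classical in
/-- One pass of the outer loop of the neighborhood computation around `B`, for `x ∈ B`.
The state is the pair (neighbors found so far, elements not yet mapped). -/
def neighborStep (M : Matroid E) (B : Finset E)
    (s : Finset (Finset E) × Finset E) (x : E) : Finset (Finset E) × Finset E :=
  let S := s.2.filter (fun e => M.IsBase (↑(insert e (B.erase x)) : Set E))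
  (s.1 ∪ S.image (fun e => insert e (B.erase x)), s.2 \ S)

/-- `𝒩` is an output of the neighborhood computation for the basis `B` and the values `w`, for some
ordering of the elements of `B` by nondecreasing value (ties are ordered arbitrarily). -/
def IsNeighborhood (M : Matroid E) (B : Finset E) (w : E → ℝ)
    (𝒩 : Finset (Finset E)) : Prop :=
  ∃ l : List E, l.Nodup ∧ (∀ e, e ∈ l ↔ e ∈ B) ∧ l.Pairwise (fun a b => w a ≤ w b) ∧
    𝒩 = (l.foldl (neighborStep M B) (∅, univ \ B)).1

/-- `N_e(t)`: the number of steps `s ≤ t` (including the initial step `0`) at which the played set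
`P s` contains `e`. -/
def playCount (P : ℕ → Finset E) (t : ℕ) (e : E) : ℕ :=
  #{s ∈ range (t + 1) | e ∈ P s}

/-- The empirical mean of the rewards `x s e` over the steps `s ≤ t` at which `e` was played. -/
def empMean (x : ℕ → E → ℝ) (P : ℕ → Finset E) (t : ℕ) (e : E) : ℝ :=
  (∑ s ∈ range (t + 1) with e ∈ P s, x s e) / playCount P t e

/-- `l_B(t)`: the number of steps `s ∈ {1, …, t}` at which `B` is the leader. -/
def leaderCount (L : ℕ → Finset E) (B : Finset E) (t : ℕ) : ℕ :=
  #{s ∈ Icc 1 t | L s = B}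

/-- The optimistic index of the element `e` at step `t + 1`: empirical mean after step `t` plus the
bonus `√(2 log (l_L(t+1)) / N_e(t))`, where `L = L (t + 1)` is the leader of step `t + 1`. -/
def optIndex (x : ℕ → E → ℝ) (L P : ℕ → Finset E) (t : ℕ) (e : E) : ℝ :=
  empMean x P t e +
    √(2 * Real.log (leaderCount L (L (t + 1)) (t + 1)) / playCount P t e)

/-- The values `w` and `w'` order the elements of `B` differently. -/
def OrderChanged (B : Finset E) (w w' : E → ℝ) : Prop :=
  ∃ a ∈ B, ∃ b ∈ B, ¬ (w a ≤ w b ↔ w' a ≤ w' b)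

/-- Some member of `𝒩` has a larger value than `B`. -/
def Beaten (w : E → ℝ) (B : Finset E) (𝒩 : Finset (Finset E)) : Prop :=
  ∃ J ∈ 𝒩, weight w B < weight w J

/-- `(L, 𝒩, P)` (leaders, neighborhoods, played sets) is a trajectory of MAUB on the matroid `M`
with reward table `x`. Step `0` is the initialization, where every element is observed once and the
initial leader and neighborhood are computed; the main loop runs over the steps `t + 1`.
In `order_changed` and `keep`, the orders induced by the means available at the current and at the
previous iteration are compared; at the first iteration (`t = 0`) they coincide. -/
structure IsTrajectory (M : Matroid E) (x : ℕ → E → ℝ) (L : ℕ → Finset E)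
    (𝒩 : ℕ → Finset (Finset E)) (P : ℕ → Finset E) : Prop where
  init_play : P 0 = univ
  init_leader : IsGreedyOutput M (empMean x P 0) (L 0)
  init_nbhd : IsNeighborhood M (L 0) (empMean x P 0) (𝒩 0)
  new_leader : ∀ t, Beaten (empMean x P t) (L t) (𝒩 t) →
    IsGreedyOutput M (empMean x P t) (L (t + 1)) ∧
      IsNeighborhood M (L (t + 1)) (empMean x P t) (𝒩 (t + 1))
  order_changed : ∀ t, ¬ Beaten (empMean x P t) (L t) (𝒩 t) →
    OrderChanged (L t) (empMean x P (t - 1)) (empMean x P t) →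
      L (t + 1) = L t ∧ IsNeighborhood M (L (t + 1)) (empMean x P t) (𝒩 (t + 1))
  keep : ∀ t, ¬ Beaten (empMean x P t) (L t) (𝒩 t) →
    ¬ OrderChanged (L t) (empMean x P (t - 1)) (empMean x P t) →
      L (t + 1) = L t ∧ 𝒩 (t + 1) = 𝒩 t
  forced_play : ∀ t,
    (leaderCount L (L (t + 1)) (t + 1) - 1) % (Fintype.card E - M.eRank.toNat + 1) = 0 →
      P (t + 1) = L (t + 1)
  optimistic_play : ∀ t,
    (leaderCount L (L (t + 1)) (t + 1) - 1) % (Fintype.card E - M.eRank.toNat + 1) ≠ 0 →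
      P (t + 1) ∈ insert (L (t + 1)) (𝒩 (t + 1)) ∧
        ∀ J ∈ insert (L (t + 1)) (𝒩 (t + 1)),
          weight (optIndex x L P t) J ≤ weight (optIndex x L P t) (P (t + 1))

end

end MAUB

/-!
The expected number of steps led by a suboptimal basis `B` is in fact bounded. Throughout, let
`K = |E| - rank + 1`, and let `δ` be an eighth of a lower bound on the gaps between distinct means.

A suboptimal basis has an improving exchange `B - z + e` with `μ z < μ e`
(`exists_improving_exchange`). If the empirical means on `B` are `δ`-accurate, they order `B` as `μ`
does, so the neighborhood contains an improving neighbor for each `e` that admits one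
(`IsNeighborhood.exists_mem_of_close`). If the mean of `e` is accurate as well, `B` can neither be
kept as the leader, since this neighbor beats it, nor be returned by the greedy algorithm
(`IsTrajectory.le_of_leader`).

Say that the rewards of `e` *mislead* at level `q` if at some time, after `N` observations, the
empirical mean is off by at least both `δ` and the bonus `√(2 log q / N)`. The deterministic core
(`IsTrajectory.leaderCount_lt`) is that, without misleading rewards at a large level `q`, the basis
`B` leads at fewer than `2 q K` steps. Suppose that it leads at that many. The forced plays make the
means on `B` accurate during the second half of these steps. At the unforced steps of that half,
optimism makes some improving neighbor look better than `B`, so the played set is a neighbor of `B`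
(`IsTrajectory.exists_exchange_played`). By pigeonhole one incoming element `e` is played at least
`q / |E|` times. When it is brought in for the last time its index is accurate, so its exchange has
to be improving. But now that `e` is well explored, `B` cannot be the leader at the end.

Since `N (max δ √(2 log q / N))² ≥ N δ² / 2 + log q`, a Chernoff bound for the first `N`
observations of `e` gives misleading at level `q` a probability of at most a constant times
`∑ N, exp (-N δ²) / q²` (`measure_exists_misleads_le`). The sum over `N` converges, so this bound
does not depend on the horizon, although the bonus involves the leader count instead of the time.
The bounds are summable over `q`, so the expectation is bounded (`integral_natCast_le_of_tail`).
-/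

namespace MAUB

/-! ### Exchanges in matroids -/

section Exchange

variable {E : Type*} {M : Matroid E}

/-- Exchange with a prescribed incoming element: the fundamental circuit of `e` in `B` is not
contained in the basis `B'`. -/
lemma exists_isBase_insert_diff {B B' : Set E} (hB : M.IsBase B) (hB' : M.IsBase B') {e : E}
    (he' : e ∈ B') (he : e ∉ B) : ∃ x ∈ B \ B', M.IsBase (insert e (B \ {x})) := by
  have heE : e ∈ M.E := hB'.subset_ground he'
  have hC := hB.fundCircuit_isCircuit heE he
  obtain ⟨x, hxC, hxB'⟩ : ∃ x ∈ M.fundCircuit e B, x ∉ B' := by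
    by_contra! h
    exact hC.not_indep (hB'.indep.subset h)
  have hxe : x ≠ e := fun h => hxB' (h ▸ he')
  have hxB : x ∈ B := (M.fundCircuit_subset_insert e B hxC).resolve_left hxe
  have hI := (hB.indep.mem_fundCircuit_iff (by rw [hB.closure_eq]; exact heE) he).1 hxC
  rw [← Set.insert_sdiff_singleton_comm hxe.symm] at hI
  exact ⟨x, ⟨hxB, hxB'⟩, hB.exchange_isBase_of_indep he hI⟩

end Exchange

variable {E : Type*} [DecidableEq E] {M : Matroid E}

lemma weight_insert_erase (w : E → ℝ) {B : Finset E} {x e : E} (hx : x ∈ B) (he : e ∉ B) :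
    weight w (insert e (B.erase x)) = weight w B + w e - w x := by
  unfold weight
  rw [sum_insert (fun h => he (mem_of_mem_erase h)), ← add_sum_erase B w hx]
  ring

section

variable [Fintype E]

/-- A basis that is not of maximal weight can be improved by a single exchange. The largest element
of the symmetric difference with a maximal basis is the one to bring in. -/
lemma exists_improving_exchange {μ : E → ℝ} (hμ : Function.Injective μ) {B B' : Finset E}
    (hB : M.IsBase (B : Set E)) (hB' : M.IsBase (B' : Set E)) (hlt : weight μ B < weight μ B') :
    ∃ x ∈ B, ∃ e ∉ B, M.IsBase (↑(insert e (B.erase x)) : Set E) ∧ μ x < μ e := by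
  classical
  obtain ⟨C, hC, hmax⟩ := exists_max_image
    (univ.filter fun C : Finset E => M.IsBase (C : Set E)) (weight μ) ⟨B, by simpa using hB⟩
  simp only [mem_filter, mem_univ, true_and] at hC hmax
  have hne : (symmDiff B C).Nonempty := by
    rw [nonempty_iff_ne_empty, Ne, ← bot_eq_empty, symmDiff_eq_bot]
    rintro rfl
    exact absurd (hmax B' hB') (not_le.2 hlt)
  obtain ⟨e, he, hemax⟩ := exists_max_image _ μ hne
  have key : ∀ x, x ∈ symmDiff B C → x ≠ e → μ x < μ e := fun x hx hxe =>
    lt_of_le_of_ne (hemax x hx) fun h => hxe (hμ h)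
  rcases mem_symmDiff.1 he with ⟨heB, heC⟩ | ⟨heC, heB⟩
  · obtain ⟨x, ⟨hxC, hxB⟩, hb⟩ := exists_isBase_insert_diff hC hB
      (mem_coe.2 heB) (mt mem_coe.1 heC)
    have h1 := hmax (insert e (C.erase x)) (by simpa using hb)
    rw [weight_insert_erase μ hxC heC] at h1
    have h2 := key x (mem_symmDiff.2 (Or.inr ⟨hxC, hxB⟩)) (fun h => heC (h ▸ hxC))
    linarith
  · obtain ⟨x, ⟨hxB, hxC⟩, hb⟩ := exists_isBase_insert_diff hB hC
      (mem_coe.2 heC) (mt mem_coe.1 heB)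
    exact ⟨x, hxB, e, heB, by simpa using hb,
      key x (mem_symmDiff.2 (Or.inl ⟨hxB, hxC⟩)) (fun h => heB (h ▸ hxB))⟩

end

/-! ### The greedy algorithm and the neighborhoods -/

open Classical in
/-- A greedy output admits no improving exchange. -/
lemma IsGreedyOutput.le_of_exchange {w : E → ℝ} {B : Finset E} (h : IsGreedyOutput M w B)
    {x e : E} (hx : x ∈ B) (he : e ∉ B) (hb : M.Indep (↑(insert e (B.erase x)) : Set E)) :
    w e ≤ w x := by
  obtain ⟨l, -, hl, hs, rfl⟩ := h
  by_contra! hlt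
  set f : Finset E → E → Finset E :=
    fun I e => if M.Indep (↑(insert e I) : Set E) then insert e I else I with hf
  have hmono : ∀ (l : List E) (I : Finset E), I ⊆ l.foldl f I := by
    intro l
    induction l with
    | nil => intro I; exact subset_rfl
    | cons a l ih =>
      intro I
      refine subset_trans ?_ (ih (f I a))
      simp only [hf]
      split_ifs
      exacts [subset_insert _ _, subset_rfl]
  have hsub : ∀ (l : List E) (I : Finset E), ∀ y ∈ l.foldl f I, y ∈ I ∨ y ∈ l := by
    intro l
    induction l with
    | nil => intro I y hy; exact Or.inl hy
    | cons a l ih =>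
      intro I y hy
      rcases ih _ y hy with h | h
      · simp only [hf] at h
        split_ifs at h
        · rcases mem_insert.1 h with rfl | h
          · simp
          · exact Or.inl h
        · exact Or.inl h
      · exact Or.inr (List.mem_cons_of_mem _ h)
  obtain ⟨l₁, l₂, rfl⟩ := List.append_of_mem (hl e)
  have hx₁ : x ∉ l₁ := fun hx₁ =>
    absurd ((List.pairwise_append.1 hs).2.2 x hx₁ e (by simp)) (not_le.2 hlt)
  -- `I` is the set built when the turn of `e` comes; it does not contain `x` yet.
  set I := l₁.foldl f ∅ with hI
  have hB : greedyAlong M (l₁ ++ e :: l₂) = l₂.foldl f (f I e) := by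
    simp [greedyAlong, hI, hf, List.foldl_append]
  have hIB : I ⊆ greedyAlong M (l₁ ++ e :: l₂) := by
    rw [hB]
    refine subset_trans ?_ (hmono l₂ _)
    simp only [hf]
    split_ifs
    exacts [subset_insert _ _, subset_rfl]
  have hxI : x ∉ I := fun h => by
    rcases hsub _ _ _ h with h | h
    · simp at h
    · exact hx₁ h
  have hind : M.Indep (↑(insert e I) : Set E) := by
    refine hb.subset (coe_subset.2 (insert_subset_insert e fun y hy => ?_))
    exact mem_erase.2 ⟨fun hyx => hxI (hyx ▸ hy), hIB hy⟩
  refine he ?_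
  rw [hB]
  apply hmono
  simp only [hf]
  rw [if_pos hind]
  exact mem_insert_self _ _

open Classical in
lemma subset_foldl_neighborStep (B : Finset E) (l : List E) (s : Finset (Finset E) × Finset E) :
    s.1 ⊆ (l.foldl (neighborStep M B) s).1 := by
  induction l generalizing s with
  | nil => exact subset_rfl
  | cons a l ih => exact subset_trans subset_union_left (ih (neighborStep M B s a))

open Classical in
lemma exists_of_mem_foldl_neighborStep {B : Finset E} (l : List E)
    (s : Finset (Finset E) × Finset E) {J : Finset E}
    (hJ : J ∈ (l.foldl (neighborStep M B) s).1) :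
    J ∈ s.1 ∨ ∃ x ∈ l, ∃ e ∈ s.2, M.IsBase (↑(insert e (B.erase x)) : Set E) ∧
      J = insert e (B.erase x) := by
  induction l generalizing s with
  | nil => exact Or.inl hJ
  | cons a l ih =>
    rcases ih _ hJ with h | ⟨x, hx, e, he, h⟩
    · rcases mem_union.1 h with h | h
      · exact Or.inl h
      · obtain ⟨e, he, rfl⟩ := mem_image.1 h
        rw [mem_filter] at he
        exact Or.inr ⟨a, by simp, e, he.1, he.2, rfl⟩
    · exact Or.inr ⟨x, List.mem_cons_of_mem _ hx, e, (mem_sdiff.1 he).1, h⟩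

open Classical in
lemma mem_foldl_neighborStep {B : Finset E} {w : E → ℝ} {x e : E}
    (hb : M.IsBase (↑(insert e (B.erase x)) : Set E)) (l : List E)
    (s : Finset (Finset E) × Finset E) (hl : l.Pairwise (fun a b => w a ≤ w b)) (hx : x ∈ l)
    (he : e ∈ s.2)
    (hmin : ∀ y ∈ l, M.IsBase (↑(insert e (B.erase y)) : Set E) → y = x ∨ w x < w y) :
    insert e (B.erase x) ∈ (l.foldl (neighborStep M B) s).1 := by
  induction l generalizing s with
  | nil => simp at hx
  | cons a l ih =>
    rw [List.foldl_cons]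
    by_cases ha : M.IsBase (↑(insert e (B.erase a)) : Set E)
    · have hax : a = x := by
        rcases hmin a (by simp) ha with h | h
        · exact h
        · rcases List.mem_cons.1 hx with h' | h'
          · exact h'.symm
          · exact absurd (List.rel_of_pairwise_cons hl h') (not_le.2 h)
      subst hax
      apply subset_foldl_neighborStep
      exact mem_union_right _ (mem_image.2 ⟨e, mem_filter.2 ⟨he, ha⟩, rfl⟩)
    · have hxa : x ≠ a := fun h => ha (h ▸ hb)
      refine ih _ hl.of_cons ((List.mem_cons.1 hx).resolve_left hxa) ?_
        fun y hy => hmin y (List.mem_cons_of_mem _ hy)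
      exact mem_sdiff.2 ⟨he, fun h => ha (mem_filter.1 h).2⟩

variable [Fintype E]

lemma IsNeighborhood.exists_exchange {B : Finset E} {w : E → ℝ} {𝒩 : Finset (Finset E)}
    (h : IsNeighborhood M B w 𝒩) {J : Finset E} (hJ : J ∈ 𝒩) :
    ∃ x ∈ B, ∃ e ∉ B, M.IsBase (↑(insert e (B.erase x)) : Set E) ∧ J = insert e (B.erase x) := by
  obtain ⟨l, -, hl, -, rfl⟩ := h
  rcases exists_of_mem_foldl_neighborStep l _ hJ with h | ⟨x, hx, e, he, hb, rfl⟩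
  · simp at h
  · exact ⟨x, (hl x).1 hx, e, (mem_sdiff.1 he).2, hb, rfl⟩

/-- The cheapest exchange that brings in `e` belongs to the neighborhood. -/
lemma IsNeighborhood.mem_of_min {B : Finset E} {w : E → ℝ} {𝒩 : Finset (Finset E)}
    (h : IsNeighborhood M B w 𝒩) {x e : E} (hx : x ∈ B) (he : e ∉ B)
    (hb : M.IsBase (↑(insert e (B.erase x)) : Set E))
    (hmin : ∀ y ∈ B, M.IsBase (↑(insert e (B.erase y)) : Set E) → y = x ∨ w x < w y) :
    insert e (B.erase x) ∈ 𝒩 := by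
  obtain ⟨l, -, hl, hs, rfl⟩ := h
  exact mem_foldl_neighborStep hb l _ hs ((hl x).2 hx) (mem_sdiff.2 ⟨mem_univ _, he⟩)
    fun y hy => hmin y ((hl y).1 hy)

lemma IsNeighborhood.congr {B : Finset E} {w w' : E → ℝ} {𝒩 : Finset (Finset E)}
    (h : IsNeighborhood M B w 𝒩) (hw : ¬ OrderChanged B w w') : IsNeighborhood M B w' 𝒩 := by
  obtain ⟨l, hn, hl, hs, rfl⟩ := h
  refine ⟨l, hn, hl, hs.imp_of_mem fun {a b} ha hb hab => ?_, rfl⟩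
  by_contra hab'
  exact hw ⟨a, (hl a).1 ha, b, (hl b).1 hb, fun h => hab' (h.1 hab)⟩

/-- If the values `w` are so close to `μ` on `B` that they order `B` like `μ`, then every
improving exchange of `B` can be replaced by one that belongs to the neighborhood computed with `w`
and brings in the same element. -/
lemma IsNeighborhood.exists_mem_of_close {B : Finset E} {w μ : E → ℝ} {𝒩 : Finset (Finset E)}
    {δ : ℝ} (h : IsNeighborhood M B w 𝒩) (hsep : ∀ a b, a ≠ b → 8 * δ ≤ |μ a - μ b|)
    (hw : ∀ y ∈ B, |w y - μ y| < δ) {x e : E} (hx : x ∈ B) (he : e ∉ B)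
    (hb : M.IsBase (↑(insert e (B.erase x)) : Set E)) :
    ∃ z ∈ B, insert e (B.erase z) ∈ 𝒩 ∧ μ z ≤ μ x := by
  classical
  obtain ⟨z, hz, hzmin⟩ := exists_min_image
    (B.filter fun y => M.IsBase (↑(insert e (B.erase y)) : Set E)) μ ⟨x, mem_filter.2 ⟨hx, hb⟩⟩
  rw [mem_filter] at hz
  refine ⟨z, hz.1, h.mem_of_min hz.1 he hz.2 fun y hy hby => ?_, hzmin x (mem_filter.2 ⟨hx, hb⟩)⟩
  by_cases hyz : y = z
  · exact Or.inl hyz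
  · right
    have h1 := hsep y z hyz
    have h2 := hzmin y (mem_filter.2 ⟨hy, hby⟩)
    rw [abs_of_nonneg (sub_nonneg.2 h2)] at h1
    have h3 := abs_lt.1 (hw y hy)
    have h4 := abs_lt.1 (hw z hz.1)
    linarith

end MAUB

namespace MAUB

/-! ### Counting plays and leaders -/

section Counts

variable {E : Type*} [DecidableEq E]

lemma playCount_succ (P : ℕ → Finset E) (t : ℕ) (e : E) :
    playCount P (t + 1) e = playCount P t e + if e ∈ P (t + 1) then 1 else 0 := by
  unfold playCount
  rw [range_add_one (n := t + 1), filter_insert]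
  split_ifs with h
  · rw [card_insert_of_notMem (by simp)]
  · rfl

lemma playCount_mono (P : ℕ → Finset E) (e : E) : Monotone fun t => playCount P t e :=
  monotone_nat_of_le_succ fun t => by rw [playCount_succ]; exact Nat.le_add_right _ _

lemma playCount_zero {P : ℕ → Finset E} {e : E} (h : e ∈ P 0) : playCount P 0 e = 1 := by
  simp [playCount, filter_singleton, h]

lemma playCount_le (P : ℕ → Finset E) (t : ℕ) (e : E) : playCount P t e ≤ t + 1 :=
  (card_filter_le _ _).trans (card_range _).le

lemma leaderCount_zero (L : ℕ → Finset E) (B : Finset E) : leaderCount L B 0 = 0 := by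
  simp [leaderCount]

lemma leaderCount_succ (L : ℕ → Finset E) (B : Finset E) (t : ℕ) :
    leaderCount L B (t + 1) = leaderCount L B t + if L (t + 1) = B then 1 else 0 := by
  unfold leaderCount
  rw [← insert_Icc_right_eq_Icc_add_one (by omega), filter_insert]
  split_ifs with h
  · rw [card_insert_of_notMem (by simp)]
  · rfl

lemma leaderCount_mono (L : ℕ → Finset E) (B : Finset E) : Monotone (leaderCount L B) :=
  monotone_nat_of_le_succ fun t => by rw [leaderCount_succ]; exact Nat.le_add_right _ _

lemma leaderCount_le (L : ℕ → Finset E) (B : Finset E) (t : ℕ) : leaderCount L B t ≤ t :=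
  (card_filter_le _ _).trans (by simp)

/-- Every value below `leaderCount L B T` is the count just before some step led by `B`. -/
lemma exists_leaderCount_eq {L : ℕ → Finset E} {B : Finset E} {k T : ℕ}
    (h : k < leaderCount L B T) : ∃ s < T, L (s + 1) = B ∧ leaderCount L B s = k := by
  induction T with
  | zero => simp [leaderCount_zero] at h
  | succ T ih =>
    by_cases hk : k < leaderCount L B T
    · obtain ⟨s, hs, h⟩ := ih hk
      exact ⟨s, by omega, h⟩
    · rw [leaderCount_succ] at h
      split_ifs at h with hL
      · exact ⟨T, by omega, hL, by omega⟩
      · omega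

/-- If `e` is played at step `0` and at the steps `τ j + 1` for `j` in `F`, where `τ` is strictly
monotone on `F`, then up to step `τ k`, `k ∈ F` the last index, it has been played at least `#F`
times. -/
lemma card_le_playCount {P : ℕ → Finset E} {e : E} (h0 : e ∈ P 0) {F : Finset ℕ} {τ : ℕ → ℕ}
    (hτ : ∀ i ∈ F, ∀ j ∈ F, i < j → τ i < τ j) (hF : ∀ j ∈ F, e ∈ P (τ j + 1)) {k : ℕ}
    (hk : k ∈ F) (hmax : ∀ j ∈ F, j ≤ k) : #F ≤ playCount P (τ k) e := by
  have hinj : Set.InjOn (fun j => τ j + 1) (F.erase k : Finset ℕ) := by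
    intro i hi j hj hij
    have hi' := mem_of_mem_erase (mem_coe.1 hi)
    have hj' := mem_of_mem_erase (mem_coe.1 hj)
    simp only [add_left_inj] at hij
    rcases lt_trichotomy i j with h | h | h
    · exact absurd (hτ i hi' j hj' h) (by omega)
    · exact h
    · exact absurd (hτ j hj' i hi' h) (by omega)
  have hsub : insert 0 ((F.erase k).image fun j => τ j + 1) ⊆
      (range (τ k + 1)).filter fun s => e ∈ P s := by
    intro s hs
    rcases mem_insert.1 hs with rfl | hs
    · simpa using h0
    · obtain ⟨j, hj, rfl⟩ := mem_image.1 hs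
      obtain ⟨hjk, hj⟩ := mem_erase.1 hj
      have := hτ j hj k hk (lt_of_le_of_ne (hmax j hj) hjk)
      exact mem_filter.2 ⟨mem_range.2 (by omega), hF j hj⟩
  have := card_le_card hsub
  rw [card_insert_of_notMem (by simp), card_image_of_injOn hinj, card_erase_add_one hk] at this
  exact this

end Counts

/-! ### Optimistic indices -/

section Index

variable {E : Type*} [DecidableEq E] {x : ℕ → E → ℝ} {L P : ℕ → Finset E}

/-- The rewards of `e` up to step `s` mislead at level `q`: the empirical mean is off by at least
`δ`, and by at least the bonus belonging to a leader count `q`. -/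
def Misleads (x : ℕ → E → ℝ) (P : ℕ → Finset E) (μ : E → ℝ) (δ : ℝ) (q s : ℕ) (e : E) : Prop :=
  δ ≤ |empMean x P s e - μ e| ∧
    2 * Real.log q ≤ playCount P s e * (empMean x P s e - μ e) ^ 2

lemma abs_empMean_sub_lt {μ : E → ℝ} {δ : ℝ} (hδ : 0 ≤ δ) {q s : ℕ} {e : E}
    (hgood : ¬ Misleads x P μ δ q s e) (hN : 2 * Real.log q ≤ δ ^ 2 * playCount P s e) :
    |empMean x P s e - μ e| < δ := by
  by_contra! hle
  refine hgood ⟨hle, hN.trans ?_⟩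
  rw [mul_comm, ← sq_abs (empMean x P s e - μ e)]
  gcongr

/-- Optimism: the index of an element that does not mislead is almost its mean. -/
lemma sub_le_optIndex {μ : E → ℝ} {δ : ℝ} (hδ : 0 ≤ δ) {q s : ℕ} {e : E}
    (hgood : ¬ Misleads x P μ δ q s e) (hN : 1 ≤ playCount P s e) (hq : 1 ≤ q)
    (hl : q ≤ leaderCount L (L (s + 1)) (s + 1)) : μ e - δ ≤ optIndex x L P s e := by
  unfold optIndex
  set b := √(2 * Real.log (leaderCount L (L (s + 1)) (s + 1)) / playCount P s e) with hb
  have hb0 : 0 ≤ b := Real.sqrt_nonneg _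
  by_cases h1 : δ ≤ |empMean x P s e - μ e|
  · have h2 : playCount P s e * (empMean x P s e - μ e) ^ 2 < 2 * Real.log q :=
      not_le.1 fun h2 => hgood ⟨h1, h2⟩
    have h3 : |empMean x P s e - μ e| ≤ b := by
      rw [← Real.sqrt_sq_eq_abs]
      apply Real.sqrt_le_sqrt
      rw [le_div_iff₀ (by exact_mod_cast hN), mul_comm]
      refine h2.le.trans ?_
      gcongr
    have := (abs_le.1 h3).1
    linarith
  · have := (abs_lt.1 (not_le.1 h1)).1
    linarith

lemma optIndex_le_add {μ : E → ℝ} {δ : ℝ} (hδ : 0 ≤ δ) {s : ℕ} {e : E}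
    (hacc : |empMean x P s e - μ e| < δ) (hN : 1 ≤ playCount P s e)
    (hl : 2 * Real.log (leaderCount L (L (s + 1)) (s + 1)) ≤ δ ^ 2 * playCount P s e) :
    optIndex x L P s e ≤ μ e + 2 * δ := by
  have h1 : √(2 * Real.log (leaderCount L (L (s + 1)) (s + 1)) / playCount P s e) ≤ δ :=
    Real.sqrt_le_iff.2 ⟨hδ, (div_le_iff₀ (by exact_mod_cast hN)).2 hl⟩
  have := (abs_lt.1 hacc).2
  unfold optIndex
  linarith

end Index

/-! ### Trajectories -/

variable {E : Type*} [Fintype E] [DecidableEq E] {M : Matroid E} {x : ℕ → E → ℝ}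
  {L : ℕ → Finset E} {𝒩 : ℕ → Finset (Finset E)} {P : ℕ → Finset E}

namespace IsTrajectory

lemma one_le_playCount (h : IsTrajectory M x L 𝒩 P) (t : ℕ) (e : E) : 1 ≤ playCount P t e := by
  rw [← playCount_zero (P := P) (e := e) (by simp [h.init_play])]
  exact playCount_mono P e (Nat.zero_le t)

/-- Keeping the old neighborhood while the order of the leader's elements is unchanged amounts to
recomputing it: at every step the neighborhood is one for the most recent means. -/
lemma isNeighborhood (h : IsTrajectory M x L 𝒩 P) (t : ℕ) :
    IsNeighborhood M (L t) (empMean x P (t - 1)) (𝒩 t) := by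
  induction t with
  | zero => exact h.init_nbhd
  | succ t ih =>
    rw [Nat.add_sub_cancel]
    by_cases hb : Beaten (empMean x P t) (L t) (𝒩 t)
    · exact (h.new_leader t hb).2
    · by_cases ho : OrderChanged (L t) (empMean x P (t - 1)) (empMean x P t)
      · exact (h.order_changed t hb ho).2
      · obtain ⟨h1, h2⟩ := h.keep t hb ho
        rw [h1, h2]
        exact ih.congr ho

/-- The forced plays: each element of `B` is played at least once every
`|E| - rank + 1` steps led by `B`. -/
lemma leaderCount_le_mul_playCount (h : IsTrajectory M x L 𝒩 P) {B : Finset E} {e : E}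
    (he : e ∈ B) (t : ℕ) :
    leaderCount L B t ≤ (Fintype.card E - M.eRank.toNat + 1) * playCount P t e := by
  set K := Fintype.card E - M.eRank.toNat + 1 with hK
  -- The initial observation and the forced plays so far, about `leaderCount / K` of them.
  suffices H : (leaderCount L B t + (K - 1)) / K + 1 ≤ playCount P t e by
    have h1 := Nat.div_add_mod (leaderCount L B t + (K - 1)) K
    have h2 := Nat.mod_lt (leaderCount L B t + (K - 1)) (show 0 < K by omega)
    have h3 := Nat.mul_le_mul_left K H
    rw [mul_add, mul_one] at h3
    omega
  induction t with
  | zero =>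
    rw [leaderCount_zero, zero_add, Nat.div_eq_of_lt (by omega)]
    exact h.one_le_playCount 0 e
  | succ t ih =>
    rw [leaderCount_succ]
    split_ifs with hL
    · have hf := h.forced_play t
      rw [hL, leaderCount_succ, if_pos hL, Nat.add_sub_cancel, ← hK] at hf
      have h4 : (leaderCount L B t + 1 + (K - 1)) / K = leaderCount L B t / K + 1 := by
        rw [show leaderCount L B t + 1 + (K - 1) = leaderCount L B t + K by omega,
          Nat.add_div_right _ (by omega)]
      by_cases h0 : leaderCount L B t % K = 0
      · rw [playCount_succ, if_pos (by rw [hf h0]; exact he), h4]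
        have := Nat.div_le_div_right (c := K) (Nat.le_add_right (leaderCount L B t) (K - 1))
        omega
      · refine le_trans ?_ (ih.trans (playCount_mono P e (Nat.le_succ t)))
        rw [h4]
        have h5 : leaderCount L B t / K + 1 ≤ (leaderCount L B t + (K - 1)) / K := by
          rw [← Nat.add_div_right _ (show 0 < K by omega), Nat.le_div_iff_mul_le (by omega)]
          have h6 := Nat.div_add_mod (leaderCount L B t) K
          rw [Nat.add_div_right _ (show 0 < K by omega), Nat.succ_mul, mul_comm]
          omega
        omega
    · exact (add_zero (leaderCount L B t) ▸ ih).trans (playCount_mono P e (Nat.le_succ t))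

/-- If the means on the leader `B` are accurate now and one step before, and the mean of `e` is
accurate now, then no exchange of `B` that brings in `e` is improving. -/
lemma le_of_leader (h : IsTrajectory M x L 𝒩 P) {μ : E → ℝ} {δ : ℝ}
    (hsep : ∀ a b, a ≠ b → 8 * δ ≤ |μ a - μ b|) {B : Finset E} {t : ℕ} (hL : L (t + 1) = B)
    (hacc' : ∀ y ∈ B, |empMean x P (t - 1) y - μ y| < δ)
    (hacc : ∀ y ∈ B, |empMean x P t y - μ y| < δ) {z e : E} (hz : z ∈ B) (he : e ∉ B)
    (hb : M.IsBase (↑(insert e (B.erase z)) : Set E))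
    (hacce : |empMean x P t e - μ e| < δ) : μ e ≤ μ z := by
  by_contra! hlt
  have main : ∃ y ∈ B, empMean x P t e ≤ empMean x P t y ∧ μ y ≤ μ z := by
    by_cases hbt : Beaten (empMean x P t) (L t) (𝒩 t)
    · have hg := (h.new_leader t hbt).1
      rw [hL] at hg
      exact ⟨z, hz, hg.le_of_exchange hz he hb.indep, le_rfl⟩
    · have hLt : L t = B := by
        by_cases ho : OrderChanged (L t) (empMean x P (t - 1)) (empMean x P t)
        · exact (h.order_changed t hbt ho).1.symm.trans hL
        · exact (h.keep t hbt ho).1.symm.trans hL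
      have hn := h.isNeighborhood t
      rw [hLt] at hn hbt
      obtain ⟨y, hy, hyn, hyz⟩ := hn.exists_mem_of_close hsep hacc' hz he hb
      refine ⟨y, hy, ?_, hyz⟩
      by_contra! hey
      refine hbt ⟨_, hyn, ?_⟩
      rw [weight_insert_erase _ hy he]
      linarith
  obtain ⟨y, hy, hey, hyz⟩ := main
  have h1 := hsep e y (fun h => he (h ▸ hy))
  rw [abs_of_nonneg (by linarith)] at h1
  have h2 := abs_lt.1 (hacc y hy)
  have h3 := abs_lt.1 hacce
  linarith

end IsTrajectory

/-- At an unforced step led by `B`, if `B` has an improving exchange and the means of its elements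
are accurate, the played set is a neighbor of `B`. If moreover the incoming element has been played
often, it is an improving neighbor. -/
lemma IsTrajectory.exists_exchange_played (h : IsTrajectory M x L 𝒩 P) {μ : E → ℝ} {δ : ℝ}
    (hδ : 0 < δ) (hsep : ∀ a b, a ≠ b → 8 * δ ≤ |μ a - μ b|) {q s : ℕ} (hq : 1 ≤ q)
    (hgood : ∀ e, ¬ Misleads x P μ δ q s e) {B : Finset E} (hL : L (s + 1) = B)
    (himp : ∃ z ∈ B, ∃ e ∉ B, M.IsBase (↑(insert e (B.erase z)) : Set E) ∧ μ z < μ e)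
    (hql : q ≤ leaderCount L B (s + 1))
    (hunforced : (leaderCount L B (s + 1) - 1) % (Fintype.card E - M.eRank.toNat + 1) ≠ 0)
    (hN : ∀ y ∈ B, 2 * Real.log (leaderCount L B (s + 1)) ≤ δ ^ 2 * playCount P s y) :
    ∃ z ∈ B, ∃ e ∉ B, M.IsBase (↑(insert e (B.erase z)) : Set E) ∧ e ∈ P (s + 1) ∧
      (2 * Real.log (leaderCount L B (s + 1)) ≤ δ ^ 2 * playCount P s e → μ z < μ e) := by
  subst hL
  have hqlog : 2 * Real.log q ≤ 2 * Real.log (leaderCount L (L (s + 1)) (s + 1)) := by gcongr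
  have hacc : ∀ e, 2 * Real.log (leaderCount L (L (s + 1)) (s + 1)) ≤ δ ^ 2 * playCount P s e →
      |empMean x P s e - μ e| < δ := fun e he =>
    abs_empMean_sub_lt hδ.le (hgood e) (hqlog.trans he)
  have hge : ∀ e, μ e - δ ≤ optIndex x L P s e := fun e =>
    sub_le_optIndex hδ.le (hgood e) (h.one_le_playCount s e) hq hql
  have hle : ∀ e, 2 * Real.log (leaderCount L (L (s + 1)) (s + 1)) ≤ δ ^ 2 * playCount P s e →
      optIndex x L P s e ≤ μ e + 2 * δ := fun e he =>
    optIndex_le_add hδ.le (hacc e he) (h.one_le_playCount s e) he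
  obtain ⟨z₁, hz₁, e₀, he₀, hb₀, hlt₁⟩ := himp
  have hn := h.isNeighborhood (s + 1)
  rw [Nat.add_sub_cancel] at hn
  obtain ⟨z₀, hz₀, hmem, hz₀₁⟩ :=
    hn.exists_mem_of_close hsep (fun y hy => hacc y (hN y hy)) hz₁ he₀ hb₀
  have hgap := hsep e₀ z₀ (fun h => he₀ (h ▸ hz₀))
  rw [abs_of_nonneg (by linarith)] at hgap
  obtain ⟨hP, hmax⟩ := h.optimistic_play s hunforced
  have h0 := hmax _ (mem_insert_of_mem hmem)
  rw [weight_insert_erase _ hz₀ he₀] at h0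
  have h1 := hge e₀
  have h2 := hle z₀ (hN z₀ hz₀)
  rcases mem_insert.1 hP with hPL | hPn
  · rw [hPL] at h0
    linarith
  · obtain ⟨z, hz, e, he, hb, hPe⟩ := hn.exists_exchange hPn
    refine ⟨z, hz, e, he, hb, hPe ▸ mem_insert_self _ _, fun hNe => ?_⟩
    rw [hPe, weight_insert_erase _ hz he] at h0
    have h3 := hge z
    have h4 := hle e hNe
    linarith

/-- The deterministic core: on a trajectory without misleading rewards at level `q`, a basis with an
improving exchange leads at fewer than `2 q (|E| - rank + 1)` steps. -/
theorem IsTrajectory.leaderCount_lt (h : IsTrajectory M x L 𝒩 P) {μ : E → ℝ} {δ : ℝ}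
    (hδ : 0 < δ) (hsep : ∀ a b, a ≠ b → 8 * δ ≤ |μ a - μ b|) {B : Finset E}
    (hB : M.IsBase (B : Set E))
    (himp : ∃ z ∈ B, ∃ e ∉ B, M.IsBase (↑(insert e (B.erase z)) : Set E) ∧ μ z < μ e)
    {q T : ℕ} (hq : 1 ≤ q)
    (hlog : 2 * Real.log (2 * q * (Fintype.card E - M.eRank.toNat + 1 : ℕ)) * Fintype.card E ≤
      δ ^ 2 * q)
    (hgood : ∀ s < T, ∀ e, ¬ Misleads x P μ δ q s e) :
    leaderCount L B T < 2 * q * (Fintype.card E - M.eRank.toNat + 1) := by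
  classical
  by_contra! hT
  set K := Fintype.card E - M.eRank.toNat + 1 with hK
  set m := Fintype.card E with hm
  -- There is an element outside `B`, so some of the steps are unforced.
  have hK2 : 2 ≤ K := by
    obtain ⟨-, -, e, he, -, -⟩ := himp
    have h1 : #B < m := card_lt_univ_of_notMem he
    have h2 : M.eRank.toNat = #B := by
      rw [← hB.encard_eq_eRank, Set.encard_coe_eq_coe_finsetCard]
      rfl
    omega
  have hm0 : 0 < m := by
    obtain ⟨z, -⟩ := himp
    exact Fintype.card_pos_iff.2 ⟨z⟩
  have hm0' : (0 : ℝ) < m := by exact_mod_cast hm0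
  have hqK : 2 * q ≤ q * K := by rw [mul_comm]; exact Nat.mul_le_mul_left q hK2
  -- An element played at least `q / m` times is well explored.
  have hexpl : ∀ {l N : ℕ}, 1 ≤ l → l ≤ 2 * q * K → q ≤ m * N →
      2 * Real.log l ≤ δ ^ 2 * N := by
    intro l N hl1 hl hN
    have h1 : Real.log l ≤ Real.log (2 * q * (K : ℕ)) :=
      Real.log_le_log (by exact_mod_cast hl1) (by exact_mod_cast hl)
    have h2 : (q : ℝ) ≤ m * N := by exact_mod_cast hN
    have h3 : 2 * Real.log (2 * q * (K : ℕ)) * m ≤ δ ^ 2 * N * m := by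
      refine hlog.trans ?_
      rw [mul_assoc, mul_comm (N : ℝ)]
      gcongr
    have := le_of_mul_le_mul_right h3 hm0'
    linarith
  -- Elements of `B` are well explored once `B` has led `q * K - K + 1` times.
  have hexplB : ∀ {s : ℕ} {y : E}, y ∈ B → q * K < leaderCount L B s + K →
      q ≤ m * playCount P s y := by
    intro s y hy hs
    have h1 := h.leaderCount_le_mul_playCount hy s
    rw [← hK] at h1
    have h2 : q * K < (playCount P s y + 1) * K := by
      rw [add_mul, one_mul, mul_comm (playCount P s y)]
      omega
    have h3 := lt_of_mul_lt_mul_right h2 (Nat.zero_le K)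
    exact (Nat.lt_succ_iff.1 h3).trans (Nat.le_mul_of_pos_left _ hm0)
  -- The steps `τ j + 1`, `q ≤ j < 2 q`, are unforced and led by `B`.
  have hτ : ∀ j ∈ Ico q (2 * q), ∃ s < T, L (s + 1) = B ∧ leaderCount L B s = j * K + 1 := by
    intro j hj
    refine exists_leaderCount_eq (lt_of_lt_of_le ?_ hT)
    have : (j + 1) * K ≤ 2 * q * K := Nat.mul_le_mul_right K (mem_Ico.1 hj).2
    rw [add_mul] at this
    omega
  choose! τ hτT hτL hτc using hτ
  have hτc' : ∀ j ∈ Ico q (2 * q), leaderCount L B (τ j + 1) = j * K + 2 := fun j hj => by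
    rw [leaderCount_succ, if_pos (hτL j hj), hτc j hj]
  have hjK : ∀ j ∈ Ico q (2 * q), q * K ≤ j * K ∧ j * K + 2 ≤ 2 * q * K := by
    intro j hj
    have h1 : (j + 1) * K ≤ 2 * q * K := Nat.mul_le_mul_right K (mem_Ico.1 hj).2
    rw [add_mul] at h1
    exact ⟨Nat.mul_le_mul_right K (mem_Ico.1 hj).1, by omega⟩
  have hplay : ∀ j ∈ Ico q (2 * q), ∃ e, ∃ z ∈ B, e ∉ B ∧
      M.IsBase (↑(insert e (B.erase z)) : Set E) ∧ e ∈ P (τ j + 1) ∧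
      (2 * Real.log (leaderCount L B (τ j + 1)) ≤ δ ^ 2 * playCount P (τ j) e → μ z < μ e) := by
    intro j hj
    have h1 := hjK j hj
    have hc := hτc' j hj
    obtain ⟨z, hz, e, he, hb⟩ := h.exists_exchange_played hδ hsep hq
      (hgood _ (hτT j hj)) (hτL j hj) himp (by omega)
      (by
        rw [hc, ← hK, show j * K + 2 - 1 = 1 + j * K by omega, Nat.add_mul_mod_self_right,
          Nat.mod_eq_of_lt (by omega)]
        exact one_ne_zero)
      (fun y hy => hexpl (by omega) (by omega)
        (hexplB hy (by have := hτc j hj; omega)))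
    exact ⟨e, z, hz, he, hb⟩
  have : Nonempty E := Fintype.card_pos_iff.1 hm0
  choose! ε hε using hplay
  -- Pigeonhole: one element `e` is brought in at `q / m` of these steps.
  obtain ⟨e, -, hcard⟩ := exists_le_card_fiber_of_nsmul_le_card_of_maps_to
    (s := Ico q (2 * q)) (t := (univ : Finset E)) (f := ε) (b := (q : ℝ) / m)
    (fun _ _ => mem_univ _) ⟨himp.choose, mem_univ _⟩
    (by
      rw [card_univ, ← hm, Nat.card_Ico, show 2 * q - q = q by omega, nsmul_eq_mul,
        mul_div_cancel₀ _ hm0'.ne'])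
  set F := (Ico q (2 * q)).filter fun j => ε j = e with hF
  have hqF : q ≤ m * #F := by
    rw [div_le_iff₀ hm0', mul_comm] at hcard
    exact_mod_cast hcard
  have hFne : F.Nonempty := card_pos.1 (Nat.pos_of_ne_zero fun h0 => by rw [h0] at hqF; omega)
  obtain ⟨k, hkF, hkmax⟩ := exists_max_image F id hFne
  have hFI : ∀ j ∈ F, j ∈ Ico q (2 * q) ∧ ε j = e := fun j hj => mem_filter.1 hj
  obtain ⟨hkI, hke⟩ := hFI k hkF
  have hτmono : ∀ i ∈ F, ∀ j ∈ F, i < j → τ i < τ j := by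
    intro i hi j hj hij
    by_contra! hle
    have h1 := leaderCount_mono L B hle
    rw [hτc i (hFI i hi).1, hτc j (hFI j hj).1] at h1
    have := Nat.mul_lt_mul_of_pos_right hij (show 0 < K by omega)
    omega
  have hNe : #F ≤ playCount P (τ k) e :=
    card_le_playCount (by simp [h.init_play]) hτmono
      (fun j hj => by
        obtain ⟨hjI, hje⟩ := hFI j hj
        obtain ⟨-, -, -, -, hP, -⟩ := hε j hjI
        exact hje ▸ hP) hkF hkmax
  have hqe : ∀ {s : ℕ}, τ k ≤ s → q ≤ m * playCount P s e := fun hs =>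
    hqF.trans (Nat.mul_le_mul_left m (hNe.trans (playCount_mono P e hs)))
  -- By the time of the last of them `e` is well explored, so its exchange is improving.
  obtain ⟨z, hz, he, hb, -, hlt⟩ := hε k hkI
  rw [hke] at he hb hlt
  rw [hτc' k hkI] at hlt
  have hlt := hlt (hexpl (Nat.le_add_left 1 _) (hjK k hkI).2 (hqe le_rfl))
  have hqK' : 2 * q * K = q * K + q * K := by ring
  have hKqK : K ≤ q * K := Nat.le_mul_of_pos_left K hq
  -- This exchange prevents `B` from leading for the `2 * q * K`-th time.
  obtain ⟨t, htT, htL, htc⟩ := exists_leaderCount_eq (L := L) (B := B) (T := T)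
    (k := 2 * q * K - 1) (by omega)
  have hkt : τ k ≤ t := by
    by_contra! hlt'
    have h1 := leaderCount_mono L B (Nat.succ_le_of_lt hlt')
    rw [hτc k hkI, leaderCount_succ, if_pos htL, htc] at h1
    have := (hjK k hkI).2
    omega
  have ht1 : leaderCount L B t ≤ leaderCount L B (t - 1) + 1 := by
    rcases t with _ | t
    · simp
    · rw [leaderCount_succ, Nat.add_sub_cancel]
      split_ifs <;> omega
  have hacc : ∀ {s : ℕ} {y : E}, s < T → q ≤ m * playCount P s y →
      |empMean x P s y - μ y| < δ := fun hs hy =>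
    abs_empMean_sub_lt hδ.le (hgood _ hs _) (hexpl hq (by omega) hy)
  refine absurd (h.le_of_leader hsep htL (fun y hy => hacc (by omega) (hexplB hy ?_))
    (fun y hy => hacc htT (hexplB hy ?_)) hz he hb (hacc htT (hqe hkt))) (not_le.2 hlt)
  · omega
  · omega

end MAUB

namespace MAUB

/-! ### Deviation of the rewards observed at predictable steps -/

section Deviation

open scoped ENNReal NNReal

variable {Ω : Type*} [mΩ : MeasurableSpace Ω] {Pr : Measure Ω}
  {𝓕 : Filtration ℕ mΩ}

/-- A product of nonnegative factors of mean at most `1`, each independent of the past and included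
or skipped according to a predictable event `A t`, has mean at most `1`. -/
lemma lintegral_prod_ite_le_one {Y : ℕ → Ω → ℝ≥0∞} {A : ℕ → Set Ω}
    [∀ t, DecidablePred (· ∈ A t)] (hYm : ∀ t, Measurable[𝓕 t] (Y t))
    (hind : ∀ t, Indep (MeasurableSpace.comap (Y (t + 1)) inferInstance) (𝓕 t) Pr)
    (hY : ∀ t, ∫⁻ ω, Y t ω ∂Pr ≤ 1) (hA₀ : A 0 = Set.univ)
    (hA : ∀ t, MeasurableSet[𝓕 t] (A (t + 1))) (T : ℕ) :
    ∫⁻ ω, ∏ t ∈ range (T + 1), (if ω ∈ A t then Y t ω else 1) ∂Pr ≤ 1 := by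
  have hG : ∀ T, Measurable[𝓕 T]
      fun ω => ∏ t ∈ range (T + 1), (if ω ∈ A t then Y t ω else 1) := by
    intro T
    refine Finset.measurable_prod _ fun t ht => ?_
    have htT : t ≤ T := Nat.lt_succ_iff.1 (mem_range.1 ht)
    refine Measurable.ite ?_ ((hYm t).mono (𝓕.mono htT) le_rfl) measurable_const
    rcases t with _ | t
    · change MeasurableSet[𝓕 T] (A 0)
      rw [hA₀]
      exact @MeasurableSet.univ _ (𝓕 T)
    · exact 𝓕.mono (by omega) _ (hA t)
  induction T with
  | zero => simpa [hA₀] using hY 0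
  | succ T ih =>
    set G := fun ω => ∏ t ∈ range (T + 1), (if ω ∈ A t then Y t ω else 1) with hGdef
    have hsplit : ∀ ω, ∏ t ∈ range (T + 1 + 1), (if ω ∈ A t then Y t ω else 1) =
        (A (T + 1)).indicator G ω * Y (T + 1) ω + (A (T + 1))ᶜ.indicator G ω := by
      intro ω
      rw [prod_range_succ]
      by_cases h : ω ∈ A (T + 1) <;> simp [h, hGdef]
    have hAG : Measurable[𝓕 T] ((A (T + 1)).indicator G) := (hG T).indicator (hA T)
    have hA' := 𝓕.le T _ (hA T)
    have hYT : Measurable (Y (T + 1)) := (hYm _).mono (𝓕.le _) le_rfl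
    simp_rw [hsplit]
    rw [lintegral_add_left ((hAG.mono (𝓕.le T) le_rfl).fun_mul hYT),
      lintegral_mul_eq_lintegral_mul_lintegral_of_independent_measurableSpace (𝓕.le T)
        hYT.comap_le (hind T).symm hAG (comap_measurable _),
      lintegral_indicator hA', lintegral_indicator hA'.compl]
    calc _ ≤ (∫⁻ ω in A (T + 1), G ω ∂Pr) * 1 + ∫⁻ ω in (A (T + 1))ᶜ, G ω ∂Pr := by
          gcongr
          exact hY _
      _ = ∫⁻ ω, G ω ∂Pr := by rw [mul_one, lintegral_add_compl _ hA']
      _ ≤ 1 := ih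

variable {E : Type*} [DecidableEq E]

/-- Chernoff bound for the sum of the first `n` observed rewards of `e`, uniformly over the time at
which the `n`-th observation occurs. The exponential supermartingale ignores the observations
after the `n`-th. -/
lemma measure_exists_playCount_eq_le {D : ℕ → Ω → ℝ} {c : ℝ≥0}
    (hDm : ∀ t, Measurable[𝓕 t] (D t))
    (hind : ∀ t, Indep (MeasurableSpace.comap (D (t + 1)) inferInstance) (𝓕 t) Pr)
    (hD : ∀ t, HasSubgaussianMGF (D t) c Pr) {P : ℕ → Ω → Finset E} {e : E}
    (hP₀ : ∀ ω, e ∈ P 0 ω) (hP : ∀ t, MeasurableSet[𝓕 t] {ω | e ∈ P (t + 1) ω})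
    {n : ℕ} (hn : 1 ≤ n) (l a : ℝ) (T : ℕ) :
    Pr {ω | ∃ t < T, playCount (fun s => P s ω) t e = n ∧
      a ≤ l * ∑ s ∈ range (t + 1) with e ∈ P s ω, D s ω} ≤
      ENNReal.ofReal (Real.exp (n * (c * l ^ 2 / 2) - a)) := by
  classical
  set Y : ℕ → Ω → ℝ≥0∞ := fun t ω =>
    ENNReal.ofReal (Real.exp (l * D t ω - c * l ^ 2 / 2)) with hYdef
  set A : ℕ → Set Ω := fun t => {ω | e ∈ P t ω} ∩ {ω | playCount (fun s => P s ω) t e ≤ n}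
    with hAdef
  have hφ : Measurable fun d : ℝ => ENNReal.ofReal (Real.exp (l * d - c * l ^ 2 / 2)) := by
    fun_prop
  have hYm : ∀ t, Measurable[𝓕 t] (Y t) := fun t => hφ.comp (hDm t)
  have hYind : ∀ t, Indep (MeasurableSpace.comap (Y (t + 1)) inferInstance) (𝓕 t) Pr := fun t =>
    indep_of_indep_of_le_left (hind t) (hφ.comp (comap_measurable (D (t + 1)))).comap_le
  have hY : ∀ t, ∫⁻ ω, Y t ω ∂Pr ≤ 1 := by
    intro t
    have h1 : ∀ ω, Real.exp (l * D t ω - c * l ^ 2 / 2) =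
        Real.exp (l * D t ω) * Real.exp (-(c * l ^ 2 / 2)) := fun ω => by
      rw [← Real.exp_add, sub_eq_add_neg]
    simp only [hYdef]
    rw [← ofReal_integral_eq_lintegral_ofReal, ENNReal.ofReal_le_one]
    · simp_rw [h1]
      rw [integral_mul_const, Real.exp_neg, ← div_eq_mul_inv, div_le_one (Real.exp_pos _)]
      exact (hD t).mgf_le l
    · simp_rw [h1]
      exact ((hD t).integrable_exp_mul l).mul_const _
    · exact Eventually.of_forall fun ω => (Real.exp_pos _).le
  have hA₀ : A 0 = Set.univ := by
    ext ω
    simp [hAdef, hP₀, playCount_zero (P := fun s => P s ω) (hP₀ ω), hn]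
  have hA : ∀ t, MeasurableSet[𝓕 t] (A (t + 1)) := by
    intro t
    have hN : Measurable[𝓕 t] fun ω => playCount (fun s => P s ω) (t + 1) e := by
      simp only [playCount, card_filter]
      refine Finset.measurable_sum _ fun s hs => Measurable.ite ?_ measurable_const measurable_const
      rcases s with _ | s
      · simp [hP₀]
      · exact 𝓕.mono (by have := mem_range.1 hs; omega) _ (hP s)
    exact (hP t).inter (hN measurableSet_Iic)
  refine le_trans (measure_mono ?_) (le_trans (meas_ge_le_lintegral_div (μ := Pr)
    (f := fun ω => ∏ t ∈ range (T + 1), (if ω ∈ A t then Y t ω else 1))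
    (ε := ENNReal.ofReal (Real.exp (a - n * (c * l ^ 2 / 2)))) ?_ ?_ ENNReal.ofReal_ne_top) ?_)
  · rintro ω ⟨t, htT, hN, ha⟩
    have hfilter : (range (T + 1)).filter (fun s => ω ∈ A s) =
        (range (t + 1)).filter fun s => e ∈ P s ω := by
      ext s
      simp only [mem_filter, mem_range, hAdef, Set.mem_inter_iff, Set.mem_ofPred_eq]
      constructor
      · rintro ⟨hs, hes, hsn⟩
        refine ⟨?_, hes⟩
        by_contra! hts
        obtain ⟨s, rfl⟩ : ∃ r, s = r + 1 := ⟨s - 1, by omega⟩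
        rw [playCount_succ, if_pos hes] at hsn
        have := playCount_mono (fun s => P s ω) e (show t ≤ s by omega)
        simp only at this
        omega
      · rintro ⟨hs, hes⟩
        exact ⟨by omega, hes,
          (playCount_mono (fun s => P s ω) e (show s ≤ t by omega)).trans_eq hN⟩
    have hcard : #((range (t + 1)).filter fun s => e ∈ P s ω) = n := hN
    rw [Set.mem_ofPred_eq, ← prod_filter, hfilter]
    simp only [hYdef]
    rw [← ENNReal.ofReal_prod_of_nonneg fun _ _ => (Real.exp_pos _).le, ← Real.exp_sum]
    refine ENNReal.ofReal_le_ofReal (Real.exp_le_exp.2 ?_)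
    rw [sum_sub_distrib, ← mul_sum, sum_const, hcard, nsmul_eq_mul]
    linarith
  · refine (Finset.measurable_prod _ fun t _ => Measurable.ite ?_
      ((hYm t).mono (𝓕.le t) le_rfl) measurable_const).aemeasurable
    change MeasurableSet (A t)
    rcases t with _ | t
    · rw [hA₀]; exact MeasurableSet.univ
    · exact 𝓕.le t _ (hA t)
  · simpa using Real.exp_pos _
  · rw [show n * (c * l ^ 2 / 2) - a = -(a - n * (c * l ^ 2 / 2)) by ring, Real.exp_neg,
      ENNReal.ofReal_inv_of_pos (Real.exp_pos _), ← one_div]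
    gcongr
    exact lintegral_prod_ite_le_one hYm hYind hY hA₀ hA T

/-- With `n` observations, misleading at level `q` is a deviation by at least
`r = max δ √(2 log q / n)`, of probability at most `2 exp (-2 n r²) ≤ 2 exp (-n δ²) / q²`. Summing
over `n` costs only a constant factor. -/
lemma measure_exists_misleads_le {X : ℕ → E → Ω → ℝ} {μ : E → ℝ} {e : E}
    (hXm : ∀ t, Measurable[𝓕 t] (X t e))
    (hind : ∀ t, Indep (MeasurableSpace.comap (X (t + 1) e) inferInstance) (𝓕 t) Pr)
    (hX : ∀ t, HasSubgaussianMGF (fun ω => X t e ω - μ e) (1 / 4) Pr) {P : ℕ → Ω → Finset E}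
    (hP₀ : ∀ ω, e ∈ P 0 ω) (hP : ∀ t, MeasurableSet[𝓕 t] {ω | e ∈ P (t + 1) ω})
    {δ : ℝ} (hδ : 0 < δ) {q : ℕ} (hq : 1 ≤ q) (T : ℕ) :
    Pr {ω | ∃ s < T, Misleads (fun t e => X t e ω) (fun t => P t ω) μ δ q s e} ≤
      ENNReal.ofReal (2 * (1 - Real.exp (-δ ^ 2))⁻¹ / q ^ 2) := by
  set D : ℕ → Ω → ℝ := fun t ω => X t e ω - μ e with hDdef
  have hDm : ∀ t, Measurable[𝓕 t] (D t) := fun t => (hXm t).sub_const _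
  have hDind : ∀ t, Indep (MeasurableSpace.comap (D (t + 1)) inferInstance) (𝓕 t) Pr := fun t =>
    indep_of_indep_of_le_left (hind t)
      ((comap_measurable (X (t + 1) e)).sub_const (μ e)).comap_le
  have hq' : (0 : ℝ) < q := by exact_mod_cast hq
  have hlog : 0 ≤ Real.log q := Real.log_natCast_nonneg q
  set r : ℕ → ℝ := fun n => max δ √(2 * Real.log q / n) with hr
  -- The Chernoff exponent `l r - l² / 8` per observation is largest, `2 r²`, at `l = 4 r`.
  set ev : ℕ → ℝ → Set Ω := fun n l => {ω | ∃ t < T, playCount (fun s => P s ω) t e = n ∧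
      4 * n * r n ^ 2 ≤ l * ∑ s ∈ range (t + 1) with e ∈ P s ω, D s ω} with hev
  have hsub : {ω | ∃ s < T, Misleads (fun t e => X t e ω) (fun t => P t ω) μ δ q s e} ⊆
      ⋃ n ∈ Icc 1 T, (ev n (4 * r n) ∪ ev n (-(4 * r n))) := by
    rintro ω ⟨s, hs, h1, h2⟩
    set n := playCount (fun t => P t ω) s e with hn
    have hn1 : 1 ≤ n := by
      rw [← playCount_zero (P := fun t => P t ω) (hP₀ ω)]
      exact playCount_mono _ e (Nat.zero_le s)
    have hnT : n ≤ T := (playCount_le _ s e).trans hs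
    have hn0 : (0 : ℝ) < n := by exact_mod_cast hn1
    set d := empMean (fun t e => X t e ω) (fun t => P t ω) s e - μ e with hd
    have hsum : ∑ t ∈ range (s + 1) with e ∈ P t ω, D t ω = n * d := by
      have hc : #((range (s + 1)).filter fun t => e ∈ P t ω) = n := rfl
      rw [hd, empMean, ← hn, mul_sub, mul_div_cancel₀ _ hn0.ne']
      simp only [hDdef]
      rw [sum_sub_distrib, sum_const, hc, nsmul_eq_mul]
    have hrd : r n ≤ |d| := by
      refine max_le h1 ?_
      rw [← Real.sqrt_sq_eq_abs]
      apply Real.sqrt_le_sqrt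
      exact (div_le_iff₀' hn0).2 h2
    have hr0 : 0 < r n := lt_max_of_lt_left hδ
    have key : 4 * n * r n ^ 2 ≤ 4 * r n * (n * |d|) := by
      have := mul_le_mul_of_nonneg_left hrd (show 0 ≤ 4 * n * r n by positivity)
      linarith
    refine Set.mem_biUnion (mem_coe.2 (mem_Icc.2 ⟨hn1, hnT⟩)) ?_
    rcases abs_cases d with ⟨h, -⟩ | ⟨h, -⟩
    · exact Or.inl ⟨s, hs, rfl, by rw [hsum, ← h]; exact key⟩
    · refine Or.inr ⟨s, hs, rfl, ?_⟩
      rw [hsum]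
      rw [h] at key
      linarith
  have hev_le : ∀ n ∈ Icc 1 T, ∀ l, l ^ 2 = 16 * r n ^ 2 →
      Pr (ev n l) ≤ ENNReal.ofReal (Real.exp (-δ ^ 2) ^ n / q ^ 2) := by
    intro n hn l hl
    have hn1 := (mem_Icc.1 hn).1
    have hn0 : (0 : ℝ) < n := by exact_mod_cast hn1
    refine (measure_exists_playCount_eq_le hDm hDind hX hP₀ hP hn1 l _ T).trans
      (ENNReal.ofReal_le_ofReal ?_)
    have h1 : δ ^ 2 ≤ r n ^ 2 := by
      gcongr
      exact le_max_left _ _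
    have h2 : 2 * Real.log q ≤ n * r n ^ 2 := by
      rw [mul_comm, ← div_le_iff₀' hn0, mul_comm]
      rw [← Real.sq_sqrt (show 0 ≤ 2 * Real.log q / n by positivity)]
      gcongr
      exact le_max_right _ _
    have h3 : Real.exp (-δ ^ 2) ^ n / q ^ 2 = Real.exp (-(n * δ ^ 2) - 2 * Real.log q) := by
      rw [Real.exp_sub, ← Real.exp_nat_mul, two_mul, Real.exp_add, Real.exp_log hq', ← sq, mul_neg]
    rw [h3, hl]
    apply Real.exp_le_exp.2
    have h4 := mul_le_mul_of_nonneg_left h1 hn0.le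
    push_cast
    linarith
  have hρ : Real.exp (-δ ^ 2) < 1 := Real.exp_lt_one_iff.2 (by have := pow_pos hδ 2; linarith)
  calc _ ≤ Pr (⋃ n ∈ Icc 1 T, (ev n (4 * r n) ∪ ev n (-(4 * r n)))) := measure_mono hsub
    _ ≤ ∑ n ∈ Icc 1 T, Pr (ev n (4 * r n) ∪ ev n (-(4 * r n))) := measure_biUnion_finset_le _ _
    _ ≤ ∑ n ∈ Icc 1 T, ENNReal.ofReal (2 * (Real.exp (-δ ^ 2) ^ n / q ^ 2)) := by
        refine sum_le_sum fun n hn => (measure_union_le _ _).trans ?_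
        rw [two_mul, ENNReal.ofReal_add (by positivity) (by positivity)]
        exact add_le_add (hev_le n hn _ (by ring)) (hev_le n hn _ (by ring))
    _ = ENNReal.ofReal (∑ n ∈ Icc 1 T, 2 * (Real.exp (-δ ^ 2) ^ n / q ^ 2)) :=
        (ENNReal.ofReal_sum_of_nonneg fun n _ => by positivity).symm
    _ ≤ _ := by
        refine ENNReal.ofReal_le_ofReal ?_
        rw [← mul_sum, ← sum_div, mul_div_assoc]
        gcongr
        rw [← tsum_geometric_of_lt_one (Real.exp_pos _).le hρ]
        exact (summable_geometric_of_lt_one (Real.exp_pos _).le hρ).sum_le_tsum _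
          fun _ _ => by positivity

end Deviation

end MAUB

namespace MAUB

/-! ### Expected number of steps led by a suboptimal basis -/

lemma exists_separation {E : Type*} [Finite E] {μ : E → ℝ} (hμ : Function.Injective μ) :
    ∃ δ > 0, ∀ a b, a ≠ b → 8 * δ ≤ |μ a - μ b| := by
  have h : ∀ᶠ δ in nhdsWithin (0 : ℝ) (Set.Ioi 0), ∀ a b, a ≠ b → 8 * δ ≤ |μ a - μ b| := by
    refine eventually_all.2 fun a => eventually_all.2 fun b =>
      eventually_imp_distrib_left.2 fun hab => ?_
    have hpos : 0 < |μ a - μ b| / 8 := by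
      have := abs_pos.2 (sub_ne_zero.2 fun h => hab (hμ h))
      positivity
    filter_upwards [Ioc_mem_nhdsGT hpos] with δ hδ
    linarith [hδ.2]
  obtain ⟨δ, h, hδ⟩ := (h.and self_mem_nhdsWithin).exists
  exact ⟨δ, hδ, h⟩

lemma eventually_log_mul_le {k m ε : ℝ} (hk : 0 < k) (hε : 0 < ε) (hm : 0 ≤ m) :
    ∀ᶠ q : ℕ in atTop, 2 * Real.log (2 * q * k) * m ≤ ε * q := by
  have ht : Tendsto (fun q : ℕ => 2 * (q : ℝ) * k) atTop atTop :=
    (tendsto_natCast_atTop_atTop.const_mul_atTop two_pos).atTop_mul_const hk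
  have ho := (Real.isLittleO_log_id_atTop.comp_tendsto ht).bound
    (show 0 < ε / (4 * k * (m + 1)) by positivity)
  filter_upwards [ho] with q hq
  simp only [Function.comp, id, Real.norm_eq_abs] at hq
  have h1 := (le_abs_self _).trans hq
  rw [abs_of_nonneg (by positivity)] at h1
  calc 2 * Real.log (2 * q * k) * m ≤ 2 * (ε / (4 * k * (m + 1)) * (2 * q * k)) * m := by gcongr
    _ = ε * q * (m / (m + 1)) := by field_simp; norm_num
    _ ≤ ε * q * 1 := by
        gcongr
        exact (div_le_one (by positivity)).2 (by linarith)
    _ = ε * q := mul_one _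

/-- The mean of a bounded count is controlled by the tail probabilities at the multiples of `k`. -/
lemma integral_natCast_le_of_tail {Ω : Type*} [MeasurableSpace Ω] {Pr : Measure Ω}
    [IsProbabilityMeasure Pr] {Z : Ω → ℕ} (hZ : Measurable Z) {T k : ℕ} (hk : 0 < k)
    (hT : ∀ ω, Z ω ≤ T) {g : ℕ → ℝ} (hg : Summable g) (hg0 : ∀ q, 0 ≤ g q)
    (htail : ∀ q, 1 ≤ q → Pr.real {ω | q * k ≤ Z ω} ≤ g q) :
    ∫ ω, (Z ω : ℝ) ∂Pr ≤ k * (1 + ∑' q, g q) := by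
  have hms : ∀ q, MeasurableSet {ω | q * k ≤ Z ω} := fun q => hZ measurableSet_Ici
  have hint : ∀ q, Integrable ({ω | q * k ≤ Z ω}.indicator fun _ => (1 : ℝ)) Pr := fun q =>
    (integrable_const 1).indicator (hms q)
  have hpt : ∀ ω, (Z ω : ℝ) ≤
      k * (1 + ∑ q ∈ Icc 1 T, {ω | q * k ≤ Z ω}.indicator (fun _ => (1 : ℝ)) ω) := by
    intro ω
    have h1 : ∑ q ∈ Icc 1 T, {ω | q * k ≤ Z ω}.indicator (fun _ => (1 : ℝ)) ω =
        #{q ∈ Icc 1 T | q * k ≤ Z ω} := by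
      rw [card_filter, Nat.cast_sum]
      refine sum_congr rfl fun q _ => ?_
      by_cases h : q * k ≤ Z ω <;> simp [h]
    have h2 : Icc 1 (Z ω / k) ⊆ {q ∈ Icc 1 T | q * k ≤ Z ω} := by
      intro q hq
      obtain ⟨hq1, hq2⟩ := mem_Icc.1 hq
      exact mem_filter.2 ⟨mem_Icc.2 ⟨hq1, hq2.trans ((Nat.div_le_self _ _).trans (hT ω))⟩,
        (Nat.le_div_iff_mul_le hk).1 hq2⟩
    have h3 := card_le_card h2
    rw [Nat.card_Icc, Nat.add_sub_cancel] at h3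
    have h4 := Nat.lt_mul_div_succ (Z ω) hk
    have h5 : Z ω ≤ k * (1 + #{q ∈ Icc 1 T | q * k ≤ Z ω}) :=
      h4.le.trans (Nat.mul_le_mul_left k (by omega))
    rw [h1]
    exact_mod_cast h5
  have hZi : Integrable (fun ω => (Z ω : ℝ)) Pr :=
    Integrable.of_bound (measurable_from_nat.comp hZ).aestronglyMeasurable (T : ℝ)
      (Eventually.of_forall fun ω => by simpa using hT ω)
  have hSi : Integrable (fun ω => ∑ q ∈ Icc 1 T,
      {ω | q * k ≤ Z ω}.indicator (fun _ => (1 : ℝ)) ω) Pr :=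
    integrable_finsetSum _ fun q _ => hint q
  refine (integral_mono hZi (((integrable_const 1).add hSi).const_mul _) hpt).trans ?_
  rw [integral_const_mul, integral_add' (integrable_const 1) hSi,
    integral_finsetSum _ fun q _ => hint q]
  simp only [integral_indicator (hms _), integral_const, smul_eq_mul, mul_one, probReal_univ,
    MeasurableSet.univ, measureReal_restrict_apply, Set.univ_inter]
  gcongr
  exact (sum_le_sum fun q hq => htail q (mem_Icc.1 hq).1).trans (hg.sum_le_tsum _ fun q _ => hg0 q)

end MAUB

theorem mainTheorem2 {E : Type*} [Fintype E] [DecidableEq E]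
    (M : Matroid E) (hM : M.E = Set.univ)
    {Ω : Type*} [mΩ : MeasurableSpace Ω] (Pr : Measure Ω) [IsProbabilityMeasure Pr]
    (μ : E → ℝ) (hμ_pos : ∀ e, 0 < μ e) (hμ_inj : Function.Injective μ)
    (X : ℕ → E → Ω → ℝ)
    (𝓕 : Filtration ℕ mΩ)
    (hX_adapted : ∀ t e, Measurable[𝓕 t] (X t e))
    (hX_indep : ∀ t, Indep
      (MeasurableSpace.comap (fun ω e => X (t + 1) e ω) MeasurableSpace.pi) (𝓕 t) Pr)
    (hX_ident : ∀ t e, IdentDistrib (X t e) (X 0 e) Pr Pr)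
    (hX_mean : ∀ t e, ∫ ω, X t e ω ∂Pr = μ e)
    (hX_subG : ∀ t e, HasSubgaussianMGF (fun ω => X t e ω - μ e) (1 / 4) Pr)
    (L : ℕ → Ω → Finset E) (𝒩 : ℕ → Ω → Finset (Finset E)) (P : ℕ → Ω → Finset E)
    (hL : ∀ t B, MeasurableSet[𝓕 t] {ω | L (t + 1) ω = B})
    (hP : ∀ t B, MeasurableSet[𝓕 t] {ω | P (t + 1) ω = B})
    (hMAUB : ∀ ω, MAUB.IsTrajectory M (fun t e => X t e ω)
      (fun t => L t ω) (fun t => 𝒩 t ω) (fun t => P t ω))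
    (B : Finset E) (hB : M.IsBase (B : Set E))
    (hB_subopt : ∃ B' : Finset E, M.IsBase (B' : Set E) ∧ MAUB.weight μ B < MAUB.weight μ B') :
    (fun T : ℕ => ∫ ω, (MAUB.leaderCount (fun t => L t ω) B T : ℝ) ∂Pr)
      =O[atTop] (fun T : ℕ => Real.log (Real.log T)) := by
  obtain ⟨B', hB', hlt⟩ := hB_subopt
  have himp := MAUB.exists_improving_exchange hμ_inj hB hB' hlt
  obtain ⟨δ, hδ, hsep⟩ := MAUB.exists_separation hμ_inj
  set K := Fintype.card E - M.eRank.toNat + 1 with hK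
  have hK0 : 0 < K := Nat.succ_pos _
  obtain ⟨q₀, hq₀⟩ := eventually_atTop.1 (MAUB.eventually_log_mul_le (k := K)
    (m := Fintype.card E) (Nat.cast_pos.2 hK0) (pow_pos hδ 2) (Nat.cast_nonneg _))
  set C : ℝ := Fintype.card E * (2 * (1 - Real.exp (-δ ^ 2))⁻¹) with hC
  have hρ : 0 < 1 - Real.exp (-δ ^ 2) :=
    sub_pos.2 (Real.exp_lt_one_iff.2 (by have := pow_pos hδ 2; linarith))
  have hC0 : 0 ≤ C := by positivity
  have hindX : ∀ e t, Indep (MeasurableSpace.comap (X (t + 1) e) inferInstance) (𝓕 t) Pr :=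
    fun e t => indep_of_indep_of_le_left (hX_indep t)
      ((measurable_pi_apply e).comp (comap_measurable fun ω e => X (t + 1) e ω)).comap_le
  have hPm : ∀ e t, MeasurableSet[𝓕 t] {ω | e ∈ P (t + 1) ω} := by
    intro e t
    have : {ω | e ∈ P (t + 1) ω} = ⋃ J ∈ {J : Finset E | e ∈ J}, {ω | P (t + 1) ω = J} := by
      ext ω; simp
    rw [this]
    exact MeasurableSet.biUnion (Set.to_countable _) fun J _ => hP t J
  have hLm : ∀ T, Measurable fun ω => MAUB.leaderCount (fun t => L t ω) B T := by
    intro T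
    simp only [MAUB.leaderCount, card_filter]
    refine Finset.measurable_sum _ fun s hs => Measurable.ite ?_ measurable_const measurable_const
    obtain ⟨t, rfl⟩ : ∃ t, s = t + 1 := ⟨s - 1, by have := (mem_Icc.1 hs).1; omega⟩
    exact 𝓕.le t _ (hL t B)
  -- Leading for `2 q K` steps requires misleading rewards at level `q`.
  have htail : ∀ T q, q₀ ≤ q → 1 ≤ q →
      Pr.real {ω | q * (2 * K) ≤ MAUB.leaderCount (fun t => L t ω) B T} ≤ C / q ^ 2 := by
    intro T q hqq hq
    refine ENNReal.toReal_le_of_le_ofReal (by positivity) ?_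
    calc _ ≤ Pr (⋃ e ∈ (univ : Finset E), {ω | ∃ s < T,
          MAUB.Misleads (fun t e => X t e ω) (fun t => P t ω) μ δ q s e}) := by
          refine measure_mono fun ω hω => ?_
          by_contra hcon
          simp only [Set.mem_iUnion, mem_univ, exists_prop, true_and, Set.mem_ofPred_eq,
            not_exists, not_and] at hcon
          refine absurd ((hMAUB ω).leaderCount_lt hδ hsep hB himp hq (hq₀ q hqq)
            fun s hs e => hcon e s hs) (not_lt.2 ?_)
          rw [mul_comm 2 q, mul_assoc]
          exact hω
      _ ≤ ∑ e : E, ENNReal.ofReal (2 * (1 - Real.exp (-δ ^ 2))⁻¹ / q ^ 2) :=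
          (measure_biUnion_finset_le _ _).trans (sum_le_sum fun e _ =>
            MAUB.measure_exists_misleads_le (fun t => hX_adapted t e) (hindX e)
              (fun t => hX_subG t e) (fun ω => by simp [(hMAUB ω).init_play]) (hPm e) hδ hq T)
      _ = ENNReal.ofReal (C / q ^ 2) := by
          rw [sum_const, card_univ, nsmul_eq_mul, hC, mul_div_assoc (Fintype.card E : ℝ),
            ENNReal.ofReal_mul (Nat.cast_nonneg _), ENNReal.ofReal_natCast]
  set g : ℕ → ℝ := fun q => (if q < q₀ then 1 else 0) + C / q ^ 2 with hg
  have hgs : Summable g := by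
    refine Summable.add ?_ ?_
    · exact summable_of_ne_finset_zero (s := range q₀) fun q hq => if_neg (by simpa using hq)
    · simp_rw [div_eq_mul_inv]
      exact (Real.summable_nat_pow_inv.2 one_lt_two).mul_left C
  have hg0 : ∀ q, 0 ≤ g q := fun q => add_nonneg (by split_ifs <;> norm_num) (by positivity)
  -- The tails are summable, so the expectation is even bounded.
  have hbound : ∀ T, ∫ ω, (MAUB.leaderCount (fun t => L t ω) B T : ℝ) ∂Pr ≤
      (2 * K : ℕ) * (1 + ∑' q, g q) := fun T => by
    refine MAUB.integral_natCast_le_of_tail (hLm T) (by omega)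
      (fun ω => MAUB.leaderCount_le _ B T) hgs hg0 fun q hq => ?_
    by_cases hqq : q < q₀
    · refine measureReal_le_one.trans ?_
      simp only [hg, if_pos hqq]
      exact le_add_of_nonneg_right (by positivity)
    · refine (htail T q (not_lt.1 hqq) hq).trans ?_
      simp [hg, hqq]
  have hloglog : Tendsto (fun T : ℕ => Real.log (Real.log T)) atTop atTop :=
    Real.tendsto_log_atTop.comp (Real.tendsto_log_atTop.comp tendsto_natCast_atTop_atTop)
  refine IsBigO.of_bound ((2 * K : ℕ) * (1 + ∑' q, g q)) ?_
  filter_upwards [hloglog.eventually_ge_atTop 1] with T hT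
  rw [Real.norm_of_nonneg (integral_nonneg fun ω => Nat.cast_nonneg _),
    Real.norm_of_nonneg (zero_le_one.trans hT)]
  exact (hbound T).trans (le_mul_of_one_le_right
    (mul_nonneg (Nat.cast_nonneg _) (add_nonneg zero_le_one (tsum_nonneg hg0))) hT)
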